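/- Let $X,Y$ be nonempty totally ordered sets. For $1\le k\le\infty$, a kernel $K:X\times Y\to[0,\infty)$ is $\mathrm{TN}^{(k)}$ (totally nonnegative of order $k$) if $\det(K(x_i,y_j))_{i,j=1}^r\ge 0$ for all integers $r$ with $1\le r\le k$ and all $x_1<\dots<x_r$ in $X$, $y_1<\dots<y_r$ in $Y$ (all integers $r\ge1$ if $k=\infty$). Let $p\ge1$ be an integer, let $k_1,\dots,k_p,l\in\{1,2,3,\dots\}\cup\{\infty\}$, and put $\mathcal N:=\min\{|X|,|Y|,l\}\in\{1,2,3,\dots\}\cup\{\infty\}$ (where $|X|=\infty$ if $X$ is infinite, and likewise for $Y$). Say that $F:[0,\infty)^p\to[0,\infty)$ satisfies $(*)$ if for all kernels $K_1,\dots,K_p:X\times Y\to[0,\infty)$ with $K_j$ being $\mathrm{TN}^{(k_j)}$ for every $j$, the kernel $(x,y)\mapsto F(K_1(x,y),\dots,K_p(x,y))$ is $\mathrm{TN}^{(l)}$. Use the convention $0^0:=1$ and $0^\alpha:=0$ for $\alpha>0$. 1. If $\mathcal N=1$, then every function $F:[0,\infty)^p\to[0,\infty)$ satisfies $(*)$.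 2. If $\mathcal N=2$, then $F:[0,\infty)^p\to[0,\infty)$ satisfies $(*)$ if and only if there exist a subset $J\subseteq\{1,\dots,p\}$ and constants $c\ge0$ and $\alpha_j\ge0$ $(j\in J)$ such that $$F(t_1,\dots,t_p)=c\prod_{j\in J}t_j^{\alpha_j}\prod_{i\notin J}\mathbf 1_{t_i>0}\qquad\text{for all }t\in[0,\infty)^p,$$ and such that for every $j\in\{1,\dots,p\}$ with $k_j<2$ one has $j\in J$ and $\alpha_j=0$. Moreover, if $F$ satisfies $(*)$, then in every representation of $F$ in the displayed form with $c>0$, each $j$ with $k_j<2$ lies in $J$ and has $\alpha_j=0$. 3. If $\mathcal N=3$, then $F:[0,\infty)^p\to[0,\infty)$ satisfies $(*)$ if and only if $F$ is a nonnegative constant or $F(t)=c\,t_j^{\alpha}$ for a single $j\in\{1,\dots,p\}$ with $c>0$, $\alpha\ge1$ and $k_j\ge3$. 4. If $4\le\mathcal N\le\infty$, then $F:[0,\infty)^p\to[0,\infty)$ satisfies $(*)$ if and only if $F$ is a nonnegative constant or $F(t)=c\,t_j$ for a single $j\in\{1,\dots,p\}$ with $c>0$ and $k_j\ge\mathcal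 N$. -/

import Mathlib

open scoped NNReal

/-- The strictly increasing `k`-tuples of elements of `X`. -/
def IncTuples (X : Type*) [LinearOrder X] (k : ℕ) : Set (Fin k → X) :=
  {x | StrictMono x}

/-- The "submatrix" `K[x; y] = (K(x_i, y_j))_{i,j}` of a kernel `K : X × Y → [0,∞)`,
with entries viewed as real numbers. -/
def kernelMinor {X Y : Type*} (K : X → Y → ℝ≥0) {r : ℕ} (x : Fin r → X) (y : Fin r → Y) :
    Matrix (Fin r) (Fin r) ℝ :=
  Matrix.of fun i j => (K (x i) (y j) : ℝ)

/-- `IsTN k K`: the kernel `K : X × Y → [0,∞)` is totally nonnegative of order `k`, i.e.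
`det K[x; y] ≥ 0` for all `1 ≤ r ≤ k` and strictly increasing `r`-tuples `x` in `X`, `y` in `Y`.
For `k = ⊤` all `r ≥ 1` are included, so that `IsTN ⊤` is total nonnegativity. -/
def IsTN {X Y : Type*} [LinearOrder X] [LinearOrder Y] (k : ℕ∞) (K : X → Y → ℝ≥0) : Prop :=
  ∀ r : ℕ, 1 ≤ r → (r : ℕ∞) ≤ k → ∀ x ∈ IncTuples X r, ∀ y ∈ IncTuples Y r,
    0 ≤ (kernelMinor K x y).det

/-- The kernel `F ∘ (K_1, …, K_p) : (x, y) ↦ F(K_1(x,y), …, K_p(x,y))`. -/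
def kernelTransform {X Y : Type*} {p : ℕ} (F : (Fin p → ℝ≥0) → ℝ≥0)
    (K : Fin p → X → Y → ℝ≥0) : X → Y → ℝ≥0 :=
  fun x y => F fun j => K j x y

/-- `F[-]` maps `TN^{(k_1)} × ⋯ × TN^{(k_p)}` into `TN^{(l)}`, for kernels on `X × Y`. -/
def TransformsTN (X Y : Type*) [LinearOrder X] [LinearOrder Y] {p : ℕ} (k : Fin p → ℕ∞) (l : ℕ∞)
    (F : (Fin p → ℝ≥0) → ℝ≥0) : Prop :=
  ∀ K : Fin p → X → Y → ℝ≥0, (∀ j, IsTN (k j) (K j)) → IsTN l (kernelTransform F K)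

/-- The function `t ↦ c ∏_{j ∈ J} t_j ^ α_j ∏_{i ∉ J} 1_{t_i > 0}` on `[0,∞)^p`
(the values of `α` outside `J` are not used; here `0 ^ 0 = 1`). -/
noncomputable def powerIndicator {p : ℕ} (J : Finset (Fin p)) (c : ℝ≥0) (α : Fin p → ℝ≥0) :
    (Fin p → ℝ≥0) → ℝ≥0 :=
  fun t => c * (∏ j ∈ J, t j ^ (α j : ℝ)) * ∏ i ∈ Jᶜ, if 0 < t i then 1 else 0

/-! Every chain with at least `n` elements retracts monotonically onto `Fin n`, and pulling a kernel
back along monotone maps creates only minors of the old kernel or minors with a repeated row or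
column. Necessity can therefore be tested on `n × n` matrices with `n ≤ N`; minors of order above
`N` never arise within `TN^(l)`.

Order two: singular 2 × 2 matrices force `F a * F b = F (a * b) * F 1`, and comparable ones force
monotonicity. So `F / F 1` is a monotone multiplicative map on a product, hence a product of
one-variable monotone multiplicative maps. By Cauchy's equation in logarithmic coordinates each is a
power on `(0,∞)`, and only its value at 0 remains to be decided.

Order three: images of the form `[[c,c,0],[c,d,c],[0,c,c]]` with `d < 2c` have negative determinant.
They exclude indicators, exponents in `(0,1)`, two active variables, and an active variable with `k
j < 3`. Conversely, powers `α ≥ 1` preserve order three by convexity and the Desnanot–Jacobi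
identity.

Order four and above: a family of singular totally nonnegative 4 × 4 matrices `1 + x m` acquires a
negative determinant under every power `α > 1`, by second-order Taylor expansion
(`exists_det_rpow_neg`). The bound `N ≤ k j` comes from tridiagonal Toeplitz matrices whose proper
minors are all nonnegative but whose determinant is negative (`exists_isTN_of_lt_det_neg`). -/

/-! ### Reduction to finite chains. -/

section Reduction

variable {X Y X' Y' : Type*} [LinearOrder X] [LinearOrder Y] [LinearOrder X'] [LinearOrder Y']

/-- Pulling a kernel back along monotone maps preserves total nonnegativity. -/
lemma IsTN.comp_monotone {k : ℕ∞} {K : X' → Y' → ℝ≥0} (hK : IsTN k K) {f : X → X'} {g : Y → Y'}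
    (hf : Monotone f) (hg : Monotone g) : IsTN k fun x y => K (f x) (g y) := by
  intro r hr hrk x hx y hy
  have hx : StrictMono x := hx
  have hy : StrictMono y := hy
  by_cases hfx : Function.Injective (f ∘ x)
  · by_cases hgy : Function.Injective (g ∘ y)
    · exact hK r hr hrk (f ∘ x) ((hf.comp hx.monotone).strictMono_of_injective hfx) (g ∘ y)
        ((hg.comp hy.monotone).strictMono_of_injective hgy)
    · simp only [Function.Injective, not_forall] at hgy
      obtain ⟨i, j, hij, hne⟩ := hgy
      refine (Matrix.det_zero_of_column_eq hne fun a => ?_).ge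
      have : g (y i) = g (y j) := hij
      simp [kernelMinor, this]
  · simp only [Function.Injective, not_forall] at hfx
    obtain ⟨i, j, hij, hne⟩ := hfx
    refine (Matrix.det_zero_of_row_eq hne ?_).ge
    have : f (x i) = f (x j) := hij
    funext a
    simp [kernelMinor, this]

lemma natCast_le_card_of_strictMono {r : ℕ} {x : Fin r → X} (hx : StrictMono x) :
    (r : ℕ∞) ≤ ENat.card X := by
  simpa using ENat.card_le_card_of_injective hx.injective

/-- A chain with at least `n ≥ 1` elements has `Fin n` as a monotone retract. -/
lemma exists_monotone_retraction {n : ℕ} (hn : 1 ≤ n) (h : (n : ℕ∞) ≤ ENat.card X) :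
    ∃ (f : X → Fin n) (s : Fin n → X), Monotone f ∧ StrictMono s ∧ ∀ i, f (s i) = i := by
  classical
  rw [← Set.encard_univ] at h
  obtain ⟨t, -, ht⟩ := Set.exists_subset_encard_eq h
  have hfin : t.Finite := Set.finite_of_encard_eq_coe ht
  have hcard : hfin.toFinset.card = n := by
    have := hfin.encard_eq_coe_toFinset_card
    rw [ht] at this
    exact_mod_cast this.symm
  set s := hfin.toFinset.orderEmbOfFin hcard with hs
  let c : X → ℕ := fun x => (Finset.univ.filter fun i => s i ≤ x).card
  have hc : ∀ x, c x ≤ n := fun x => by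
    simpa [c] using Finset.card_filter_le (Finset.univ : Finset (Fin n)) (fun i => s i ≤ x)
  -- `c x` counts the sample points up to `x`; truncated subtraction sends everything below the
  -- first sample to index 0.
  refine ⟨fun x => ⟨c x - 1, by have := hc x; omega⟩, s, ?_, s.strictMono, ?_⟩
  · intro x y hxy
    have : c x ≤ c y := Finset.card_le_card fun i hi => by
      simp only [Finset.mem_filter, Finset.mem_univ, true_and] at hi ⊢
      exact hi.trans hxy
    simp only [Fin.mk_le_mk]
    omega
  · intro i
    ext
    have : c (s i) = i + 1 := by
      simp only [c, OrderEmbedding.le_iff_le]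
      rw [← Fin.card_Iic]
      congr 1
      ext j
      simp
    simp [this]

/-- Transforms acting on kernels on `X × Y` also act on kernels on smaller finite chains. -/
lemma TransformsTN.fin {p : ℕ} {k : Fin p → ℕ∞} {l : ℕ∞} {F : (Fin p → ℝ≥0) → ℝ≥0}
    (hF : TransformsTN X Y k l F) {n : ℕ} (hn : 1 ≤ n) (hX : (n : ℕ∞) ≤ ENat.card X)
    (hY : (n : ℕ∞) ≤ ENat.card Y) : TransformsTN (Fin n) (Fin n) k l F := by
  obtain ⟨f, s, hf, hs, hfs⟩ := exists_monotone_retraction hn hX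
  obtain ⟨g, t, hg, ht, hgt⟩ := exists_monotone_retraction hn hY
  intro K hK
  -- Extend along the retractions, transform, then restrict along the sections.
  have h := (hF (fun j x y => K j (f x) (g y)) fun j => (hK j).comp_monotone hf hg).comp_monotone
    hs.monotone ht.monotone
  simp only [kernelTransform, hfs, hgt] at h
  exact h

end Reduction

/-! ### Total nonnegativity of small matrices. -/

lemma strictMono_fin_eq_id {n : ℕ} {x : Fin n → Fin n} (hx : StrictMono x) : x = id := by
  have h := Subsingleton.elim (hx.orderIsoOfSurjective x
    (Finite.injective_iff_surjective.1 hx.injective)) (OrderIso.refl (Fin n))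
  funext i
  exact congrArg (fun e : Fin n ≃o Fin n => e i) h

/-- On `Fin n × Fin n` the only minor of order at least `n` is the full determinant. -/
lemma isTN_fin {n : ℕ} {k : ℕ∞} {A : Fin n → Fin n → ℝ≥0}
    (h : ∀ r : ℕ, 1 ≤ r → r < n → (r : ℕ∞) ≤ k → ∀ x : Fin r → Fin n, StrictMono x →
      ∀ y : Fin r → Fin n, StrictMono y → 0 ≤ (kernelMinor A x y).det)
    (hdet : (n : ℕ∞) ≤ k → 0 ≤ (kernelMinor A id id).det) : IsTN k A := by
  intro r hr hrk x hx y hy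
  have hle : r ≤ n := by simpa using Fintype.card_le_of_injective x hx.injective
  rcases hle.lt_or_eq with hlt | rfl
  · exact h r hr hlt hrk x hx y hy
  · rw [strictMono_fin_eq_id hx, strictMono_fin_eq_id hy]
    exact hdet hrk

lemma TransformsTN.det_nonneg {n p : ℕ} {k : Fin p → ℕ∞} {l : ℕ∞} {F : (Fin p → ℝ≥0) → ℝ≥0}
    (hF : TransformsTN (Fin n) (Fin n) k l F) (hn : 1 ≤ n) (hl : (n : ℕ∞) ≤ l)
    {A : Fin p → Fin n → Fin n → ℝ≥0} (hA : ∀ j, IsTN (k j) (A j)) :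
    0 ≤ (Matrix.of fun i i' => (F (fun j => A j i i') : ℝ)).det :=
  hF A hA n hn hl id strictMono_id id strictMono_id

lemma det_kernelMinor_one_nonneg {X Y : Type*} (K : X → Y → ℝ≥0) (x : Fin 1 → X) (y : Fin 1 → Y) :
    0 ≤ (kernelMinor K x y).det := by
  simp [kernelMinor]

lemma isTN_two {k : ℕ∞} {A : Fin 2 → Fin 2 → ℝ≥0}
    (h : 2 ≤ k → A 0 1 * A 1 0 ≤ A 0 0 * A 1 1) : IsTN k A := by
  refine isTN_fin (fun r hr hr2 _ x _ y _ => ?_) fun hk => ?_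
  · obtain rfl : r = 1 := by omega
    exact det_kernelMinor_one_nonneg A x y
  · have : (A 0 1 : ℝ) * A 1 0 ≤ A 0 0 * A 1 1 := by exact_mod_cast h (by exact_mod_cast hk)
    simpa [kernelMinor, Matrix.det_fin_two] using this

lemma isTN_three {k : ℕ∞} {A : Fin 3 → Fin 3 → ℝ≥0}
    (h2 : ∀ a b c d : Fin 3, a < b → c < d → A a d * A b c ≤ A a c * A b d)
    (h3 : 3 ≤ k → 0 ≤ (kernelMinor A id id).det) : IsTN k A := by
  refine isTN_fin (fun r hr hr2 _ x hx y hy => ?_) fun hk => h3 (by exact_mod_cast hk)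
  obtain rfl | rfl : r = 1 ∨ r = 2 := by omega
  · exact det_kernelMinor_one_nonneg A x y
  · have h := h2 _ _ _ _ (hx (show (0 : Fin 2) < 1 by simp)) (hy (show (0 : Fin 2) < 1 by simp))
    have : (A (x 0) (y 1) : ℝ) * A (x 1) (y 0) ≤ A (x 0) (y 0) * A (x 1) (y 1) := by exact_mod_cast h
    simpa [kernelMinor, Matrix.det_fin_two] using this

/-- It suffices to consider minors of order at most `min (min |X| |Y|) l`. -/
lemma isTN_of_le {X Y : Type*} [LinearOrder X] [LinearOrder Y] {l N : ℕ∞}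
    (hN : N = min (min (ENat.card X) (ENat.card Y)) l) {K : X → Y → ℝ≥0} (h : IsTN N K) :
    IsTN l K := by
  intro r hr hrl x hx y hy
  refine h r hr ?_ x hx y hy
  rw [hN]
  exact le_min (le_min (natCast_le_card_of_strictMono hx) (natCast_le_card_of_strictMono hy)) hrl

lemma IsTN.mono {X Y : Type*} [LinearOrder X] [LinearOrder Y] {k k' : ℕ∞} (h : k ≤ k')
    {K : X → Y → ℝ≥0} (hK : IsTN k' K) : IsTN k K :=
  fun r hr hrk => hK r hr (hrk.trans h)

lemma isTN_const {X Y : Type*} [LinearOrder X] [LinearOrder Y] (k : ℕ∞) (c : ℝ≥0) :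
    IsTN k fun (_ : X) (_ : Y) => c := by
  intro r hr _ x _ y _
  rcases hr.eq_or_lt with rfl | hr
  · exact det_kernelMinor_one_nonneg _ x y
  · refine (Matrix.det_zero_of_row_eq (i := (⟨0, by omega⟩ : Fin r)) (j := ⟨1, hr⟩) (by simp) ?_).ge
    funext a
    simp [kernelMinor]

/-! ### Monotone multiplicative functions. -/

section Power

/-- A monotone additive function on the reals is linear. -/
lemma eq_mul_of_monotone_of_add {f : ℝ → ℝ} (hf : Monotone f) (hadd : ∀ x y, f (x + y) = f x + f y)
    (x : ℝ) : f x = x * f 1 := by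
  let g : ℝ →+ ℝ := AddMonoidHom.mk' f hadd
  have hz : ∀ (m : ℤ) (y : ℝ), f (m * y) = m * f y := fun m y => by
    have := map_zsmul g m y
    simpa [g] using this
  have hz1 : ∀ m : ℤ, f m = m * f 1 := fun m => by simpa using hz m 1
  -- `n x` lies between consecutive integers, where `f` is known to be linear; this bounds the error
  -- at `n x` by `f 1`, uniformly in `n`.
  have key : ∀ n : ℕ, n * |f x - x * f 1| ≤ f 1 := fun n => by
    have h1 := hf (Int.floor_le (n * x))
    have h2 := hf (Int.lt_floor_add_one (n * x)).le
    have h3 : f (n * x) = n * f x := by simpa using hz n x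
    have h4 : f (⌊n * x⌋ + 1 : ℝ) = (⌊n * x⌋ + 1) * f 1 := by
      rw [hadd, hz1]; ring
    have h5 : 0 ≤ f 1 := by
      have h0 : f 0 = 0 := map_zero g
      rw [← h0]
      exact hf zero_le_one
    rw [h3] at h1 h2
    rw [hz1] at h1
    rw [h4] at h2
    have h6 := mul_le_mul_of_nonneg_right (Int.floor_le (n * x)) h5
    have h7 := mul_le_mul_of_nonneg_right (Int.lt_floor_add_one (n * x)).le h5
    have h8 : (n : ℝ) * |f x - x * f 1| = |n * f x - n * x * f 1| := by
      rw [show (n : ℝ) * f x - n * x * f 1 = n * (f x - x * f 1) by ring, abs_mul, Nat.abs_cast]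
    rw [h8, abs_le]
    constructor <;> linarith
  by_contra hne
  have hpos : 0 < |f x - x * f 1| := abs_pos.2 (sub_ne_zero.2 hne)
  obtain ⟨n, hn⟩ := exists_nat_gt (f 1 / |f x - x * f 1|)
  rw [div_lt_iff₀ hpos] at hn
  exact absurd (key n) hn.not_ge

/-- A monotone multiplicative function on `[0,∞)` is a power on `(0,∞)`. -/
lemma exists_rpow_of_monotone_of_mul {g : ℝ≥0 → ℝ≥0} (hg : Monotone g) (h1 : g 1 = 1)
    (hmul : ∀ a b, g (a * b) = g a * g b) : ∃ α : ℝ≥0, ∀ s, 0 < s → g s = s ^ (α : ℝ) := by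
  have hpos : ∀ s, 0 < s → 0 < g s := fun s hs => by
    have : g s * g s⁻¹ = 1 := by rw [← hmul, mul_inv_cancel₀ hs.ne', h1]
    exact pos_iff_ne_zero.2 (left_ne_zero_of_mul_eq_one this)
  let e : ℝ → ℝ≥0 := fun x => NNReal.mk (Real.exp x) (Real.exp_pos x).le
  have he : ∀ x, 0 < e x := fun x => Real.exp_pos x
  have hge : ∀ x, 0 < (g (e x) : ℝ) := fun x => hpos _ (he x)
  let f : ℝ → ℝ := fun x => Real.log (g (e x))
  have hf : Monotone f := fun x y hxy =>
    Real.log_le_log (hge x) (hg (show e x ≤ e y from Real.exp_le_exp.2 hxy))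
  have hadd : ∀ x y, f (x + y) = f x + f y := fun x y => by
    have : e (x + y) = e x * e y := NNReal.eq (Real.exp_add x y)
    simp only [f, this, hmul, NNReal.coe_mul]
    exact Real.log_mul (hge x).ne' (hge y).ne'
  have hlin := eq_mul_of_monotone_of_add hf hadd
  have hα : 0 ≤ f 1 := by
    have h0 : f 0 = 0 := by simpa using hlin 0
    rw [← h0]
    exact hf zero_le_one
  refine ⟨NNReal.mk (f 1) hα, fun s hs => ?_⟩
  have hs' : (0 : ℝ) < s := hs
  have hes : e (Real.log s) = s := NNReal.eq (Real.exp_log hs')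
  apply NNReal.eq
  rw [NNReal.coe_rpow, Real.rpow_def_of_pos hs', NNReal.coe_mk, ← hlin]
  simp only [f, hes]
  exact (Real.exp_log (hpos s hs)).symm

/-- The factors of `powerIndicator`. -/
noncomputable def powerFactor (P : Prop) [Decidable P] (α s : ℝ≥0) : ℝ≥0 :=
  if P then s ^ (α : ℝ) else if 0 < s then 1 else 0

lemma powerIndicator_apply {p : ℕ} (J : Finset (Fin p)) (c : ℝ≥0) (α t : Fin p → ℝ≥0) :
    powerIndicator J c α t = c * ∏ j, powerFactor (j ∈ J) (α j) (t j) := by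
  rw [powerIndicator, mul_assoc, ← Finset.prod_mul_prod_compl J]
  congr 2
  · exact Finset.prod_congr rfl fun j hj => by simp [powerFactor, hj]
  · exact Finset.prod_congr rfl fun j hj => by
      rw [Finset.mem_compl] at hj
      simp [powerFactor, hj]

lemma powerFactor_mul (P : Prop) [Decidable P] (α a b : ℝ≥0) :
    powerFactor P α (a * b) = powerFactor P α a * powerFactor P α b := by
  unfold powerFactor
  split_ifs <;> simp_all [NNReal.mul_rpow, pos_iff_ne_zero]

lemma powerFactor_mono (P : Prop) [Decidable P] (α : ℝ≥0) : Monotone (powerFactor P α) := by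
  intro a b hab
  unfold powerFactor
  split_ifs with h h1 h2
  · exact NNReal.rpow_le_rpow hab α.2
  · exact le_rfl
  · exact absurd (h1.trans_le hab) h2
  · exact zero_le_one
  · exact le_rfl

lemma powerFactor_one (P : Prop) [Decidable P] (α : ℝ≥0) : powerFactor P α 1 = 1 := by
  unfold powerFactor
  split_ifs <;> simp_all

lemma powerFactor_of_eq_zero {P : Prop} [Decidable P] (hP : P) {α : ℝ≥0} (hα : α = 0) (s : ℝ≥0) :
    powerFactor P α s = 1 := by
  simp [powerFactor, hP, hα]

lemma powerIndicator_update_one {p : ℕ} (J : Finset (Fin p)) (c : ℝ≥0) (α : Fin p → ℝ≥0)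
    (j : Fin p) (s : ℝ≥0) :
    powerIndicator J c α (Function.update 1 j s) = c * powerFactor (j ∈ J) (α j) s := by
  rw [powerIndicator_apply, Finset.prod_eq_single j]
  · simp
  · intro i _ hij
    rw [Function.update_of_ne hij]
    exact powerFactor_one _ _
  · simp

end Power

/-! ### Classification at order two. -/

section OrderTwo

variable {p : ℕ} {k : Fin p → ℕ∞} {l : ℕ∞} {F : (Fin p → ℝ≥0) → ℝ≥0}

lemma TransformsTN.mul_le_mul (hF : TransformsTN (Fin 2) (Fin 2) k l F) (hl : 2 ≤ l)
    {a b c d : Fin p → ℝ≥0} (h : ∀ j, 2 ≤ k j → b j * c j ≤ a j * d j) :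
    F b * F c ≤ F a * F d := by
  have := hF.det_nonneg (by norm_num) (by exact_mod_cast hl)
    (A := fun j => ![![a j, b j], ![c j, d j]]) fun j => isTN_two (by simpa using h j)
  rw [Matrix.det_fin_two] at this
  simp only [Matrix.of_apply, Matrix.cons_val_zero, Matrix.cons_val_one, sub_nonneg] at this
  exact_mod_cast this

/-- The matrices `[[t,t'],[t',t]]` and `[[t',t],[t,t']]` are both admissible: they are constant in
the coordinates with `2 ≤ k j`, and the others are unconstrained. Together they give `F t ^ 2 = F t'
^ 2`. -/
lemma TransformsTN.eq_of_lt_two (hF : TransformsTN (Fin 2) (Fin 2) k l F) (hl : 2 ≤ l)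
    {t t' : Fin p → ℝ≥0} (h : ∀ j, 2 ≤ k j → t j = t' j) : F t = F t' := by
  have h1 := hF.mul_le_mul hl (a := t) (b := t') (c := t') (d := t) fun j hj => by rw [h j hj]
  have h2 := hF.mul_le_mul hl (a := t') (b := t) (c := t) (d := t') fun j hj => by rw [h j hj]
  exact le_antisymm (mul_self_le_mul_self_iff (zero_le) (zero_le) |>.2 h2)
    (mul_self_le_mul_self_iff (zero_le) (zero_le) |>.2 h1)

/-- The constraint on every representation of a nonzero transform. -/
lemma TransformsTN.mem_and_eq_zero (hF : TransformsTN (Fin 2) (Fin 2) k l F) (hl : 2 ≤ l)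
    {J : Finset (Fin p)} {c : ℝ≥0} {α : Fin p → ℝ≥0} (hc : 0 < c) (h : F = powerIndicator J c α)
    (j : Fin p) (hj : k j < 2) : j ∈ J ∧ α j = 0 := by
  have key : ∀ s s', powerFactor (j ∈ J) (α j) s = powerFactor (j ∈ J) (α j) s' := fun s s' => by
    have := hF.eq_of_lt_two hl (t := Function.update 1 j s) (t' := Function.update 1 j s')
      fun i hi => by
        rw [Function.update_of_ne, Function.update_of_ne] <;>
        · rintro rfl
          exact hi.not_gt hj
    rw [h, powerIndicator_update_one, powerIndicator_update_one] at this
    exact mul_left_cancel₀ hc.ne' this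
  have hJ : j ∈ J := by
    by_contra hJ
    have := key 0 1
    simp [powerFactor, hJ] at this
  refine ⟨hJ, ?_⟩
  have := key 0 1
  by_contra hα
  simp [powerFactor, hJ, hα] at this

lemma TransformsTN.eq_powerIndicator (hF : TransformsTN (Fin 2) (Fin 2) k l F) (hl : 2 ≤ l) :
    ∃ (J : Finset (Fin p)) (c : ℝ≥0) (α : Fin p → ℝ≥0),
      F = powerIndicator J c α ∧ ∀ j, k j < 2 → j ∈ J ∧ α j = 0 := by
  classical
  have hmul : ∀ a b : Fin p → ℝ≥0, F a * F b = F (a * b) * F 1 := fun a b =>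
    le_antisymm (hF.mul_le_mul hl fun j _ => by simp) (hF.mul_le_mul hl fun j _ => by simp)
  have hmono : Monotone F := fun s t hst => by
    have := hF.mul_le_mul hl (a := t) (b := s) (c := s) (d := t) fun j _ =>
      mul_le_mul' (hst j) (hst j)
    exact mul_self_le_mul_self_iff (zero_le) (zero_le) |>.2 this
  rcases eq_or_ne (F 1) 0 with h0 | h0
  · refine ⟨Finset.univ, 0, 0, ?_, by simp⟩
    funext t
    have := hmul t t
    rw [h0, mul_zero, mul_self_eq_zero] at this
    rw [this, powerIndicator_apply, zero_mul]
  set c := F 1 with hc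
  have hcpos : 0 < c := pos_iff_ne_zero.2 h0
  let G : (Fin p → ℝ≥0) →* ℝ≥0 :=
    { toFun := fun t => F t / c
      map_one' := div_self h0
      map_mul' := fun a b => by
        have := hmul a b
        field_simp
        exact this.symm }
  let g : Fin p → ℝ≥0 → ℝ≥0 := fun j s => G (Pi.mulSingle j s)
  have hgone : ∀ j, g j 1 = 1 := fun j => by simp [g]
  have hgmul : ∀ j a b, g j (a * b) = g j a * g j b := fun j a b => by
    simp only [g, Pi.mulSingle_mul, map_mul]
  have hgmono : ∀ j, Monotone (g j) := fun j a b hab => by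
    refine div_le_div_of_nonneg_right (hmono ?_) (zero_le)
    exact Pi.mulSingle_le_mulSingle.2 hab
  choose α hα using fun j => exists_rpow_of_monotone_of_mul (hgmono j) (hgone j) (hgmul j)
  -- A power on `(0,∞)` leaves only the value at 0 open, and `J` collects the coordinates where it
  -- follows the convention for `0 ^ α`. That value is idempotent, so a coordinate can fail only
  -- with `α = 0` and value 0, which is the indicator.
  let J : Finset (Fin p) := Finset.univ.filter fun j => g j 0 = 0 ^ (α j : ℝ)
  have hg01 : ∀ j, g j 0 = 0 ∨ g j 0 = 1 := fun j => by
    refine or_iff_not_imp_left.2 fun hne => mul_left_cancel₀ hne ?_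
    rw [mul_one, ← hgmul, mul_zero]
  have hg0 : ∀ j, α j ≠ 0 → g j 0 = 0 := fun j h => by
    refine (hg01 j).resolve_right fun hone => ?_
    -- Value 1 at 0 would contradict monotonicity, since `2⁻¹ ^ α < 1`.
    have h1 := hgmono j (zero_le (a := (2⁻¹ : ℝ≥0)))
    rw [hone, hα j _ (by simp)] at h1
    refine absurd h1 (not_le.2 (NNReal.rpow_lt_one ?_ (NNReal.coe_pos.2 (pos_iff_ne_zero.2 h))))
    exact inv_lt_one_of_one_lt₀ (by norm_num)
  have hJ : ∀ j, j ∉ J → g j 0 = 0 ∧ α j = 0 := fun j hj => by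
    have hj : ¬ g j 0 = 0 ^ (α j : ℝ) := by simpa [J] using hj
    have hα0 : α j = 0 := by
      by_contra h
      exact hj (by rw [hg0 j h, NNReal.zero_rpow (by exact_mod_cast h)])
    exact ⟨(hg01 j).resolve_right fun h => hj (by simp [h, hα0]), hα0⟩
  have hfac : ∀ j s, g j s = powerFactor (j ∈ J) (α j) s := fun j s => by
    unfold powerFactor
    split_ifs with h hs
    · rcases eq_zero_or_pos s with rfl | hs
      · simpa [J] using h
      · exact hα j s hs
    · simp [hα j s hs, hJ j h]
    · rw [not_lt, nonpos_iff_eq_zero] at hs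
      rw [hs, (hJ j h).1]
  have hrep : F = powerIndicator J c α := by
    funext t
    have h1 : G t = ∏ j, g j (t j) := by
      rw [← map_prod, Finset.univ_prod_mulSingle]
    rw [powerIndicator_apply, ← Finset.prod_congr rfl fun j _ => hfac j (t j), ← h1]
    exact (mul_div_cancel₀ _ h0).symm
  exact ⟨J, c, α, hrep, hF.mem_and_eq_zero hl hcpos hrep⟩

/-- Each factor is monotone and multiplicative, so it carries `b c ≤ a d` to its image; the factors
with `k j < 2` are identically 1. -/
lemma transformsTN_powerIndicator {X Y : Type*} [LinearOrder X] [LinearOrder Y]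
    (hN : 2 = min (min (ENat.card X) (ENat.card Y)) l) {J : Finset (Fin p)} {c : ℝ≥0}
    {α : Fin p → ℝ≥0} (h : ∀ j, k j < 2 → j ∈ J ∧ α j = 0) :
    TransformsTN X Y k l (powerIndicator J c α) := by
  intro K hK
  refine isTN_of_le hN fun r hr hr2 x hx y hy => ?_
  have hr2 : r ≤ 2 := by exact_mod_cast hr2
  obtain rfl | rfl : r = 1 ∨ r = 2 := by omega
  · exact det_kernelMinor_one_nonneg _ x y
  · simp only [kernelMinor, Matrix.det_fin_two, Matrix.of_apply, sub_nonneg, kernelTransform,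
      powerIndicator_apply]
    norm_cast
    rw [mul_mul_mul_comm, mul_mul_mul_comm c _ c, ← Finset.prod_mul_distrib, ← Finset.prod_mul_distrib]
    refine mul_le_mul_right (Finset.prod_le_prod' fun j _ => ?_) _
    rcases lt_or_ge (k j) 2 with hj | hj
    · obtain ⟨h1, h2⟩ := h j hj
      simp [powerFactor_of_eq_zero h1 h2]
    · rw [← powerFactor_mul, ← powerFactor_mul]
      refine powerFactor_mono _ _ ?_
      have := hK j 2 hr (by exact_mod_cast hj) x hx y hy
      simp only [kernelMinor, Matrix.det_fin_two, Matrix.of_apply, sub_nonneg] at this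
      exact_mod_cast this

end OrderTwo

/-! ### Hadamard powers of 3 × 3 matrices. -/

section HadamardPower

/-- The convex function `x ↦ x ^ α` lies above its tangent lines. -/
lemma rpow_tangent_le {x y α : ℝ} (hx : 0 ≤ x) (hy : 0 ≤ y) (hα : 1 ≤ α) :
    α * y ^ (α - 1) * (x - y) ≤ x ^ α - y ^ α := by
  rcases hy.eq_or_lt with rfl | hy
  · rcases hα.eq_or_lt with rfl | hα
    · simp
    · rw [Real.zero_rpow (by linarith), Real.zero_rpow (by linarith)]
      simpa using Real.rpow_nonneg hx α
  · have h := one_add_mul_self_le_rpow_one_add (s := x / y - 1)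
      (by linarith [div_nonneg hx hy.le]) hα
    rw [add_sub_cancel, Real.div_rpow hx hy.le, le_div_iff₀ (Real.rpow_pos_of_pos hy α)] at h
    have h1 : y ^ α = y ^ (α - 1) * y := by
      rw [Real.rpow_sub_one hy.ne', div_mul_cancel₀ _ hy.ne']
    have h2 : (1 + α * (x / y - 1)) * y ^ α = y ^ α + α * y ^ (α - 1) * (x - y) := by
      rw [h1]
      field_simp
    linarith

/-- Hadamard powers with exponent at least `1` of totally nonnegative `3 × 3` matrices have
nonnegative determinant. -/
lemma det_three_rpow_nonneg {a b c d e f g h i α : ℝ} (hα : 1 ≤ α) (ha : 0 ≤ a) (hb : 0 ≤ b)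
    (hc : 0 ≤ c) (hd : 0 ≤ d) (he : 0 ≤ e) (hf : 0 ≤ f) (hg : 0 ≤ g) (hh : 0 ≤ h) (hi : 0 ≤ i)
    (h1 : b * d ≤ a * e) (h2 : f * h ≤ e * i) (h3 : c * e ≤ b * f) (h4 : e * g ≤ d * h)
    (hdet : 0 ≤ a * e * i - a * f * h - b * d * i + b * f * g + c * d * h - c * e * g) :
    0 ≤ a ^ α * e ^ α * i ^ α - a ^ α * f ^ α * h ^ α - b ^ α * d ^ α * i ^ α
      + b ^ α * f ^ α * g ^ α + c ^ α * d ^ α * h ^ α - c ^ α * e ^ α * g ^ α := by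
  have hα0 : α ≠ 0 := by linarith
  have hα' : 0 ≤ α := by linarith
  have P : ∀ {x : ℝ}, 0 ≤ x → 0 ≤ x ^ α := fun hx => Real.rpow_nonneg hx α
  -- If the central pivot `e` vanishes, then so do `b d` and `f h`, and only nonnegative terms
  -- survive.
  rcases he.eq_or_lt with rfl | he'
  · have hbd : b ^ α * d ^ α = 0 := by
      rw [← Real.mul_rpow hb hd, le_antisymm (by simpa using h1) (mul_nonneg hb hd),
        Real.zero_rpow hα0]
    have hfh : f ^ α * h ^ α = 0 := by
      rw [← Real.mul_rpow hf hh, le_antisymm (by simpa using h2) (mul_nonneg hf hh),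
        Real.zero_rpow hα0]
    rw [Real.zero_rpow hα0, mul_assoc (a ^ α) (f ^ α), hfh, hbd]
    have := mul_nonneg (mul_nonneg (P hb) (P hf)) (P hg)
    have := mul_nonneg (mul_nonneg (P hc) (P hd)) (P hh)
    linarith
  -- Otherwise `e * det = (ae - bd)(ei - fh) - (bf - ce)(dh - eg)`, before and after taking powers.
  -- Tangents are taken at the products `bd`, `fh`, `bf`, `dh` that avoid the pivot: convexity
  -- bounds the first two differences of powers below and the last two above.
  · have t1 := rpow_tangent_le (mul_nonneg ha he) (mul_nonneg hb hd) hα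
    have t2 := rpow_tangent_le (mul_nonneg he hi) (mul_nonneg hf hh) hα
    have t3 := rpow_tangent_le (mul_nonneg hc he) (mul_nonneg hb hf) hα
    have t4 := rpow_tangent_le (mul_nonneg he hg) (mul_nonneg hd hh) hα
    have Q : ∀ {x : ℝ}, 0 ≤ x → 0 ≤ α * x ^ (α - 1) := fun hx =>
      mul_nonneg hα' (Real.rpow_nonneg hx _)
    have q1 := mul_nonneg (Q (mul_nonneg hb hd)) (sub_nonneg.2 h1)
    have q2 := mul_nonneg (Q (mul_nonneg hf hh)) (sub_nonneg.2 h2)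
    have q3 := mul_nonneg (Q (mul_nonneg hb hf)) (sub_nonneg.2 h3)
    have q4 : (d * h) ^ α - (e * g) ^ α ≥ 0 :=
      sub_nonneg.2 (Real.rpow_le_rpow (mul_nonneg he hg) h4 hα')
    have m1 := mul_le_mul t1 t2 q2 (q1.trans t1)
    have m2 : ((b * f) ^ α - (c * e) ^ α) * ((d * h) ^ α - (e * g) ^ α) ≤
        α * (b * f) ^ (α - 1) * (b * f - c * e) * (α * (d * h) ^ (α - 1) * (d * h - e * g)) :=
      mul_le_mul (by linarith) (by linarith) q4 q3
    -- Since `bd · fh = bf · dh`, the products of tangent slopes on the two sides agree, so the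
    -- inequality reduces to the case `α = 1`.
    have hprod : (b * d) ^ (α - 1) * (f * h) ^ (α - 1) = (b * f) ^ (α - 1) * (d * h) ^ (α - 1) := by
      rw [← Real.mul_rpow (mul_nonneg hb hd) (mul_nonneg hf hh),
        ← Real.mul_rpow (mul_nonneg hb hf) (mul_nonneg hd hh)]
      ring_nf
    have hmid : (b * f - c * e) * (d * h - e * g) ≤ (a * e - b * d) * (e * i - f * h) := by
      linarith [mul_nonneg he hdet]
    have m3 := mul_le_mul_of_nonneg_left hmid (mul_nonneg (Q (mul_nonneg hb hd))
      (Q (mul_nonneg hf hh)))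
    have m4 : ((b * f) ^ α - (c * e) ^ α) * ((d * h) ^ α - (e * g) ^ α) ≤
        ((a * e) ^ α - (b * d) ^ α) * ((e * i) ^ α - (f * h) ^ α) := by
      refine m2.trans (le_trans (le_of_eq ?_) (m3.trans (le_trans (le_of_eq ?_) m1)))
      · linear_combination (-(α ^ 2 * (b * f - c * e) * (d * h - e * g))) * hprod
      · ring
    rw [Real.mul_rpow hb hf, Real.mul_rpow hc he, Real.mul_rpow hd hh, Real.mul_rpow he hg,
      Real.mul_rpow ha he, Real.mul_rpow hb hd, Real.mul_rpow he hi, Real.mul_rpow hf hh] at m4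
    refine nonneg_of_mul_nonneg_right (a := e ^ α) ?_ (Real.rpow_pos_of_pos he' α)
    linarith

variable {X Y : Type*} [LinearOrder X] [LinearOrder Y]

lemma IsTN.two_le {k : ℕ∞} {K : X → Y → ℝ≥0} (hK : IsTN k K) (hk : 2 ≤ k) {x x' : X} {y y' : Y}
    (hx : x < x') (hy : y < y') : K x y' * K x' y ≤ K x y * K x' y' := by
  have h := hK 2 (by norm_num) (by exact_mod_cast hk) ![x, x'] (by simpa [IncTuples] using hx)
    ![y, y'] (by simpa [IncTuples] using hy)
  simp only [kernelMinor, Matrix.det_fin_two, Matrix.of_apply, sub_nonneg, Matrix.cons_val_zero,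
    Matrix.cons_val_one] at h
  exact_mod_cast h

lemma IsTN.const_mul {k : ℕ∞} {K : X → Y → ℝ≥0} (hK : IsTN k K) (c : ℝ≥0) :
    IsTN k fun x y => c * K x y := by
  intro r hr hrk x hx y hy
  have : kernelMinor (fun x y => c * K x y) x y = (c : ℝ) • kernelMinor K x y := by
    ext i j
    simp [kernelMinor]
  rw [this, Matrix.det_smul]
  exact mul_nonneg (pow_nonneg c.2 _) (hK r hr hrk x hx y hy)

lemma IsTN.rpow {K : X → Y → ℝ≥0} (hK : IsTN 3 K) {α : ℝ} (hα : 1 ≤ α) :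
    IsTN 3 fun x y => K x y ^ α := by
  intro r hr hr3 x hx y hy
  have hr3 : r ≤ 3 := by exact_mod_cast hr3
  have hx : StrictMono x := hx
  have hy : StrictMono y := hy
  have h2 := fun (i j i' j' : Fin r) (h : i < j) (h' : i' < j') =>
    hK.two_le (by norm_num) (hx h) (hy h')
  obtain rfl | rfl | rfl : r = 1 ∨ r = 2 ∨ r = 3 := by omega
  · exact det_kernelMinor_one_nonneg _ x y
  · simp only [kernelMinor, Matrix.det_fin_two, Matrix.of_apply, sub_nonneg]
    norm_cast
    rw [← NNReal.mul_rpow, ← NNReal.mul_rpow]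
    exact NNReal.rpow_le_rpow (h2 0 1 0 1 (by simp) (by simp)) (by linarith)
  · have hdet := hK 3 hr (by norm_num) x hx y hy
    simp only [kernelMinor, Matrix.det_fin_three, Matrix.of_apply] at hdet
    simp only [kernelMinor, Matrix.det_fin_three, Matrix.of_apply, NNReal.coe_rpow]
    have h2' : ∀ i j i' j' : Fin 3, i < j → i' < j' →
        (K (x i) (y j') : ℝ) * K (x j) (y i') ≤ K (x i) (y i') * K (x j) (y j') :=
      fun i j i' j' h h' => by exact_mod_cast h2 i j i' j' h h'
    refine det_three_rpow_nonneg hα (NNReal.coe_nonneg _) (NNReal.coe_nonneg _)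
      (NNReal.coe_nonneg _) (NNReal.coe_nonneg _) (NNReal.coe_nonneg _) (NNReal.coe_nonneg _)
      (NNReal.coe_nonneg _) (NNReal.coe_nonneg _) (NNReal.coe_nonneg _) ?_ ?_ ?_ ?_ hdet
    · exact h2' 0 1 0 1 (by simp) (by simp)
    · exact h2' 1 2 1 2 (by simp) (by simp)
    · exact h2' 0 1 1 2 (by simp) (by simp)
    · exact h2' 1 2 0 1 (by simp) (by simp)

end HadamardPower

/-! ### Classification at order three. -/

section OrderThree

/-- Total nonnegativity of a `3 × 3` matrix of natural numbers, read off from its minors. -/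
lemma isTN_three_natCast {k : ℕ∞} (M : Fin 3 → Fin 3 → ℕ)
    (h2 : ∀ a b c d : Fin 3, a < b → c < d → M a d * M b c ≤ M a c * M b d)
    (h3 : 3 ≤ k → M 0 0 * M 1 2 * M 2 1 + M 0 1 * M 1 0 * M 2 2 + M 0 2 * M 1 1 * M 2 0 ≤
      M 0 0 * M 1 1 * M 2 2 + M 0 1 * M 1 2 * M 2 0 + M 0 2 * M 1 0 * M 2 1) :
    IsTN k fun a b => (M a b : ℝ≥0) := by
  refine isTN_three (fun a b c d hab hcd => by exact_mod_cast h2 a b c d hab hcd) fun hk => ?_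
  have : (M 0 0 * M 1 2 * M 2 1 + M 0 1 * M 1 0 * M 2 2 + M 0 2 * M 1 1 * M 2 0 : ℝ) ≤
      M 0 0 * M 1 1 * M 2 2 + M 0 1 * M 1 2 * M 2 0 + M 0 2 * M 1 0 * M 2 1 := by
    exact_mod_cast h3 hk
  simp only [kernelMinor, Matrix.det_fin_three, Matrix.of_apply, id, NNReal.coe_natCast]
  linarith

variable {p : ℕ} {k : Fin p → ℕ∞} {l : ℕ∞} {F : (Fin p → ℝ≥0) → ℝ≥0}

/-- The determinant of the pattern is `c ^ 2 * (d - 2 * c)`. -/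
lemma TransformsTN.false_of_pattern (hF : TransformsTN (Fin 3) (Fin 3) k l F) (hl : 3 ≤ l)
    {A : Fin p → Fin 3 → Fin 3 → ℝ≥0} (hA : ∀ j, IsTN (k j) (A j)) {c d : ℝ≥0} (hcd : d < 2 * c)
    (hc : 0 < c)
    (h : ∀ a b, F (fun j => A j a b) = ![![c, c, 0], ![c, d, c], ![0, c, c]] a b) : False := by
  have := hF.det_nonneg (by norm_num) (by exact_mod_cast hl) hA
  simp only [h, Matrix.det_fin_three, Matrix.of_apply] at this
  simp at this
  have hcd' : (d : ℝ) < 2 * c := by exact_mod_cast hcd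
  have hc' : (0 : ℝ) < c := hc
  nlinarith [mul_pos (mul_pos hc' hc') (sub_pos.2 hcd')]

lemma isTN_update {n : ℕ} {k : Fin p → ℕ∞} {j : Fin p} {M : Fin n → Fin n → ℝ≥0}
    (hM : IsTN (k j) M) (i : Fin p) : IsTN (k i) fun a b => Function.update (1 : Fin p → ℝ≥0) j (M a b) i := by
  rcases eq_or_ne i j with rfl | h
  · simpa using hM
  · simpa [h] using isTN_const (k i) (1 : ℝ≥0)

lemma TransformsTN.exists_rpow (hF2 : TransformsTN (Fin 2) (Fin 2) k l F)
    (hF : TransformsTN (Fin 3) (Fin 3) k l F) (hl : 3 ≤ l) :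
    (∃ c : ℝ≥0, F = fun _ => c) ∨ ∃ (j : Fin p) (c : ℝ≥0) (α : ℝ),
      0 < c ∧ 1 ≤ α ∧ 3 ≤ k j ∧ F = fun t => c * t j ^ α := by
  obtain ⟨J, c, α, hrep, hk⟩ := hF2.eq_powerIndicator (le_trans (by norm_num) hl)
  rcases eq_zero_or_pos c with rfl | hc
  · exact Or.inl ⟨0, by funext t; simp [hrep, powerIndicator]⟩
  have hcase : ∀ j, j ∈ J ∧ (α j = 0 ∨ 1 ≤ α j) := by
    intro j
    by_contra hcon
    have hg0 : powerFactor (j ∈ J) (α j) 0 = 0 := by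
      unfold powerFactor
      split_ifs with h
      · exact NNReal.zero_rpow fun h0 => hcon ⟨h, Or.inl (by exact_mod_cast h0)⟩
      · simp_all
      · rfl
    have hg2 : powerFactor (j ∈ J) (α j) 2 < 2 := by
      unfold powerFactor
      split_ifs with h
      · have h1 : α j < 1 := lt_of_not_ge fun h1 => hcon ⟨h, Or.inr h1⟩
        simpa using NNReal.rpow_lt_rpow_of_exponent_lt (x := 2) (by norm_num)
          (show (α j : ℝ) < 1 by exact_mod_cast h1)
      · norm_num
      · norm_num
    -- This matrix is totally nonnegative and singular; a factor with value 0 at 0 and value below 2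
    -- at 2 makes its determinant negative.
    have hT := isTN_three_natCast (k := k j) ![![1, 1, 0], ![1, 2, 1], ![0, 1, 1]] (by decide)
      fun _ => by decide
    refine hF.false_of_pattern hl (isTN_update hT) (c := c) (d := c * powerFactor (j ∈ J) (α j) 2)
      (by rw [mul_comm 2]; exact mul_lt_mul_of_pos_left hg2 hc) hc fun a b => ?_
    change F (Function.update 1 j _) = _
    rw [hrep, powerIndicator_update_one]
    fin_cases a <;> fin_cases b <;> simp [hg0, powerFactor_one]
  have hprod : ∀ t, F t = c * ∏ j, t j ^ (α j : ℝ) := fun t => by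
    rw [hrep, powerIndicator_apply]
    congr 1
    exact Finset.prod_congr rfl fun j _ => by simp [powerFactor, (hcase j).1]
  have hzero : ∀ t : Fin p → ℝ≥0, ∀ j, α j ≠ 0 → t j = 0 → F t = 0 := fun t j hα ht => by
    rw [hprod, Finset.prod_eq_zero (Finset.mem_univ j), mul_zero]
    rw [ht, NNReal.zero_rpow (by exact_mod_cast hα)]
  have hone : ∀ t : Fin p → ℝ≥0, (∀ j, t j = 1) → F t = c := fun t ht => by simp [hprod, ht]
  have hunique : ∀ i j, α i ≠ 0 → α j ≠ 0 → i = j := by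
    intro i j hi hj
    by_contra hij
    -- `W` and its transpose are totally nonnegative, but each contributes one zero corner to the
    -- image, whose central entry is still `c`.
    let W : Fin 3 → Fin 3 → ℕ := ![![1, 1, 0], ![1, 1, 1], ![1, 1, 1]]
    refine hF.false_of_pattern hl (c := c) (d := c) (A := fun m a b =>
      if m = i then (W a b : ℝ≥0) else if m = j then (W b a : ℝ≥0) else 1) (fun m => ?_)
      (by rw [two_mul]; exact lt_add_of_pos_left _ hc) hc fun a b => ?_
    · split_ifs with h1 h2
      · exact isTN_three_natCast W (by decide) fun _ => by decide
      · exact isTN_three_natCast (fun a b => W b a) (by decide) fun _ => by decide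
      · exact isTN_const _ _
    · have h1 : ∀ a b, W a b = 1 → W b a = 1 → F (fun m =>
          if m = i then (W a b : ℝ≥0) else if m = j then (W b a : ℝ≥0) else 1) = c :=
        fun a b ha hb => hone _ fun m => by simp [ha, hb]
      have h02 : F (fun m => if m = i then (W 0 2 : ℝ≥0) else if m = j then (W 2 0 : ℝ≥0) else 1)
          = 0 := hzero _ i hi (by simp [W])
      have h20 : F (fun m => if m = i then (W 2 0 : ℝ≥0) else if m = j then (W 0 2 : ℝ≥0) else 1)
          = 0 := hzero _ j hj (by simp [W, Ne.symm hij])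
      fin_cases a <;> fin_cases b <;> first | exact h1 _ _ rfl rfl | exact h02 | exact h20
  by_cases hall : ∀ j, α j = 0
  · exact Or.inl ⟨c, by funext t; simp [hprod, hall]⟩
  push Not at hall
  obtain ⟨j, hj⟩ := hall
  refine Or.inr ⟨j, c, α j, hc, by exact_mod_cast (hcase j).2.resolve_left hj, ?_, ?_⟩
  · by_contra hkj
    -- The 2 × 2 minors are nonnegative and the determinant is `-1`, so this matrix is admissible
    -- exactly because `k j < 3`.
    have hV := isTN_three_natCast (k := k j) ![![1, 1, 0], ![1, 1, 1], ![0, 1, 1]] (by decide)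
      fun h => absurd h hkj
    refine hF.false_of_pattern hl (isTN_update hV) (c := c) (d := c)
      (by rw [two_mul]; exact lt_add_of_pos_left _ hc) hc fun a b => ?_
    have h1 : Function.update (1 : Fin p → ℝ≥0) j 1 = 1 := by simp
    have h0 : F (Function.update (1 : Fin p → ℝ≥0) j 0) = 0 := hzero _ j hj (by simp)
    have h2 : F 1 = c := hone 1 fun _ => rfl
    change F (Function.update 1 j _) = _
    fin_cases a <;> fin_cases b <;> simp [h0, h2]
  · funext t
    rw [hprod, Finset.prod_eq_single j _ (by simp)]
    intro i _ hij
    have : α i = 0 := by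
      by_contra hi
      exact hij (hunique i j hi hj)
    simp [this]

end OrderThree

/-! ### Exclusion of exponents above one at order four. -/

section ExponentOne

open Filter Topology

/-- The second order Taylor quotient of `(1 + t) ^ α` at `0`. -/
lemma tendsto_rpow_taylor_two (α : ℝ) :
    Tendsto (fun t : ℝ => ((1 + t) ^ α - 1 - α * t) / t ^ 2) (𝓝[>] 0) (𝓝 (α * (α - 1) / 2)) := by
  have hder : ∀ β t : ℝ, -1 < t →
      HasDerivAt (fun t : ℝ => (1 + t) ^ β) (β * (1 + t) ^ (β - 1)) t := fun β t ht => by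
    have := ((hasDerivAt_id t).const_add 1).rpow_const (p := β) (Or.inl (by simp; linarith))
    simpa using this
  have hpos : ∀ᶠ t : ℝ in 𝓝[>] 0, 0 < t := eventually_mem_nhdsWithin
  refine HasDerivAt.lhopital_zero_nhdsGT (f' := fun t => α * (1 + t) ^ (α - 1) - α)
    (g' := fun t => 2 * t) ?_ ?_ ?_ ?_ ?_ ?_
  · filter_upwards [hpos] with t ht
    simpa using ((hder α t (by linarith)).sub_const 1).fun_sub ((hasDerivAt_id t).const_mul α)
  · filter_upwards [hpos] with t ht
    simpa using hasDerivAt_pow 2 t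
  · filter_upwards [hpos] with t ht
    positivity
  · have h : ContinuousAt (fun t : ℝ => (1 + t) ^ α - 1 - α * t) 0 :=
      ((hder α 0 (by norm_num)).continuousAt.sub continuousAt_const).sub
        (continuousAt_const.mul continuousAt_id)
    simpa using h.tendsto.mono_left nhdsWithin_le_nhds
  · have h : ContinuousAt (fun t : ℝ => t ^ 2) 0 := by fun_prop
    simpa using h.tendsto.mono_left nhdsWithin_le_nhds
  · have h := (hasDerivAt_iff_tendsto_slope.1 (hder (α - 1) 0 (by norm_num))).mono_left
      (nhdsWithin_mono 0 fun t (ht : 0 < t) => ht.ne')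
    have h2 := h.const_mul (α / 2)
    have he : α / 2 * ((α - 1) * (1 + 0) ^ (α - 1 - 1)) = α * (α - 1) / 2 := by
      simp
      ring
    rw [he] at h2
    refine h2.congr' ?_
    filter_upwards [hpos] with t ht
    simp only [slope_def_field, add_zero, Real.one_rpow, sub_zero]
    field_simp

/-- The slopes of a one-parameter family of totally nonnegative matrices of rank at most three. -/
def rankThreeSlope : Fin 4 → Fin 4 → ℤ :=
  ![![0, 0, 0, 0], ![0, 1, 2, 3], ![0, 2, 4, 6], ![0, 2, 5, 8]]

lemma rankThreeSlope_nonneg : ∀ a b, 0 ≤ rankThreeSlope a b := by decide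

/-- The family `1 + x * rankThreeSlope`. -/
def rankThreeKernel (x : ℝ≥0) : Fin 4 → Fin 4 → ℝ≥0 :=
  fun a b => 1 + x * ((rankThreeSlope a b).toNat : ℝ≥0)

lemma coe_rankThreeKernel (x : ℝ≥0) (a b : Fin 4) :
    (rankThreeKernel x a b : ℝ) = 1 + x * (rankThreeSlope a b : ℝ) := by
  have : ((rankThreeSlope a b).toNat : ℤ) = rankThreeSlope a b :=
    Int.toNat_of_nonneg (rankThreeSlope_nonneg a b)
  simp only [rankThreeKernel, NNReal.coe_add, NNReal.coe_one, NNReal.coe_mul, NNReal.coe_natCast]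
  congr 2
  exact_mod_cast congrArg (Int.cast : ℤ → ℝ) this

/-- The all-ones matrix has rank one, so an `r × r` minor of `1 + x m` has only terms in `x ^ (r -
1)` and `x ^ r`. Nonnegativity for all `x ≥ 0` thus follows from finitely many integer inequalities;
the two conjuncts here are those coefficients for `r = 2`. -/
lemma rankThreeSlope_minor_two : ∀ a b c d : Fin 4, a < b → c < d →
    let m := rankThreeSlope
    0 ≤ m a c + m b d - m a d - m b c ∧ 0 ≤ m a c * m b d - m a d * m b c := by
  decide

/-- The two coefficients of `det (1 + x m)` for a `3 × 3` matrix `m`. -/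
def detOneAddCoeff {R : Type*} [CommRing R] (m : Fin 3 → Fin 3 → R) : R × R :=
  ((m 1 1 - m 0 1) * (m 2 2 - m 0 2) - (m 1 2 - m 0 2) * (m 2 1 - m 0 1)
    - ((m 1 0 - m 0 0) * (m 2 2 - m 0 2) - (m 1 2 - m 0 2) * (m 2 0 - m 0 0))
    + ((m 1 0 - m 0 0) * (m 2 1 - m 0 1) - (m 1 1 - m 0 1) * (m 2 0 - m 0 0)),
   m 0 0 * m 1 1 * m 2 2 - m 0 0 * m 1 2 * m 2 1 - m 0 1 * m 1 0 * m 2 2 + m 0 1 * m 1 2 * m 2 0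
    + m 0 2 * m 1 0 * m 2 1 - m 0 2 * m 1 1 * m 2 0)

set_option maxRecDepth 4000 in
lemma rankThreeSlope_minor_three : ∀ a b : Fin 4, a < b → ∀ c : Fin 4, b < c →
    ∀ d e : Fin 4, d < e → ∀ f : Fin 4, e < f →
    0 ≤ (detOneAddCoeff fun i j => rankThreeSlope (![a, b, c] i) (![d, e, f] j)).1 ∧
    0 ≤ (detOneAddCoeff fun i j => rankThreeSlope (![a, b, c] i) (![d, e, f] j)).2 := by
  decide

lemma isTN_rankThreeKernel (k : ℕ∞) (x : ℝ≥0) : IsTN k (rankThreeKernel x) := by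
  have hx0 : (0 : ℝ) ≤ x := x.2
  refine isTN_fin (fun r hr hr4 _ u hu v hv => ?_) fun _ => ?_
  · obtain rfl | rfl | rfl : r = 1 ∨ r = 2 ∨ r = 3 := by omega
    · exact det_kernelMinor_one_nonneg _ u v
    · obtain ⟨h1, h2⟩ := rankThreeSlope_minor_two (u 0) (u 1) (v 0) (v 1) (hu (by simp))
        (hv (by simp))
      have h1 := mul_nonneg hx0 (Int.cast_nonneg (R := ℝ) h1)
      have h2 := mul_nonneg (pow_nonneg hx0 2) (Int.cast_nonneg (R := ℝ) h2)
      push_cast at h1 h2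
      simp only [kernelMinor, Matrix.det_fin_two, Matrix.of_apply, coe_rankThreeKernel]
      linarith
    · obtain ⟨h1, h2⟩ := rankThreeSlope_minor_three (u 0) (u 1) (hu (by simp)) (u 2) (hu (by simp))
        (v 0) (v 1) (hv (by simp)) (v 2) (hv (by simp))
      have h1 := mul_nonneg (pow_nonneg hx0 2) (Int.cast_nonneg (R := ℝ) h1)
      have h2 := mul_nonneg (pow_nonneg hx0 3) (Int.cast_nonneg (R := ℝ) h2)
      simp only [detOneAddCoeff, Matrix.cons_val] at h1 h2
      push_cast at h1 h2
      simp only [kernelMinor, Matrix.det_fin_three, Matrix.of_apply, coe_rankThreeKernel]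
      linarith
  -- The first three rows of slopes are in arithmetic progression, so the full determinant vanishes
  -- for every `x`.
  · refine (Matrix.exists_vecMul_eq_zero_iff.1 ⟨![1, -2, 1, 0], ?_, ?_⟩).ge
    · intro h
      simpa using congrFun h 0
    · funext j
      simp only [Matrix.vecMul, dotProduct, Fin.sum_univ_four, kernelMinor, Matrix.of_apply,
        coe_rankThreeKernel, id]
      fin_cases j <;> simp [rankThreeSlope] <;> ring

lemma det_bordered_ones {R : Type*} [CommRing R] (a b c d e f g : R) :
    (Matrix.of ![![1, 1, 1, 1], ![1, 1 + a, 1 + b, 1 + c], ![1, 1 + b, 1 + d, 1 + f],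
      ![1, 1 + b, 1 + e, 1 + g]]).det =
      b * (b * f - c * d) - e * (a * f - b * c) + g * (a * d - b * b) := by
  simp [Matrix.det_succ_row_zero, Fin.sum_univ_succ, Fin.succAbove]
  ring

/-- The Hadamard powers of `rankThreeKernel` with exponent `α > 1` fail to be totally nonnegative. -/
lemma exists_det_rpow_neg {α : ℝ} (hα : 1 < α) : ∃ x : ℝ≥0,
    (Matrix.of fun a b => ((rankThreeKernel x a b ^ α : ℝ≥0) : ℝ)).det < 0 := by
  let h : ℝ → ℝ := fun t => ((1 + t) ^ α - 1 - α * t) / t ^ 2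
  let C := α * (α - 1) / 2
  have hC : 0 < C := by
    have : 0 < α - 1 := by linarith
    positivity
  -- The exact second-order remainder: `(1 + x m) ^ α = 1 + x (α m + x q m x)`, with `q m x → m ^ 2
  -- * C`.
  let q : ℝ → ℝ → ℝ := fun m x => m ^ 2 * h (m * x)
  have hpos : ∀ᶠ t : ℝ in 𝓝[>] 0, 0 < t := eventually_mem_nhdsWithin
  have hq : ∀ m : ℝ, 0 < m → Tendsto (q m) (𝓝[>] 0) (𝓝 (m ^ 2 * C)) := fun m hm => by
    refine ((tendsto_rpow_taylor_two α).comp ?_).const_mul (m ^ 2)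
    refine tendsto_nhdsWithin_iff.2 ⟨?_, ?_⟩
    · have : ContinuousAt (fun x : ℝ => m * x) 0 := by fun_prop
      simpa using this.tendsto.mono_left nhdsWithin_le_nhds
    · filter_upwards [hpos] with x hx
      exact mul_pos hm hx
  have hqe : ∀ m x : ℝ, 0 < m → 0 < x → (1 + x * m) ^ α = 1 + x * (α * m + x * q m x) :=
    fun m x hm hx => by
      simp only [q, h, mul_comm x m]
      field_simp
      ring
  -- These are the 2 × 2 minors of the rows with slopes `(1,2,3)` and `(2,4,6)`, after subtracting 1
  -- and dividing by `x ^ 3`. The rows of slopes are proportional, so the `α ^ 2` terms cancel and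
  -- the second-order terms lead.
  let m12 : ℝ → ℝ := fun x => α * (q 4 x + 4 * q 1 x - 4 * q 2 x) + x * (q 1 x * q 4 x - q 2 x ^ 2)
  let m13 : ℝ → ℝ := fun x =>
    α * (q 6 x + 6 * q 1 x - 2 * q 3 x - 3 * q 2 x) + x * (q 1 x * q 6 x - q 2 x * q 3 x)
  let m23 : ℝ → ℝ := fun x =>
    α * (2 * q 6 x + 6 * q 2 x - 3 * q 4 x - 4 * q 3 x) + x * (q 2 x * q 6 x - q 3 x * q 4 x)
  let G : ℝ → ℝ := fun x =>
    (2 * α + x * q 2 x) * m23 x - (5 * α + x * q 5 x) * m13 x + (8 * α + x * q 8 x) * m12 x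
  have hid : Tendsto (fun x : ℝ => x) (𝓝[>] 0) (𝓝 0) := nhdsWithin_le_nhds
  have q1 := hq 1 (by norm_num)
  have q2 := hq 2 (by norm_num)
  have q3 := hq 3 (by norm_num)
  have q4 := hq 4 (by norm_num)
  have q5 := hq 5 (by norm_num)
  have q6 := hq 6 (by norm_num)
  have q8 := hq 8 (by norm_num)
  have t12 := (((q4.add (q1.const_mul 4)).sub (q2.const_mul 4)).const_mul α).add
    (hid.mul ((q1.mul q4).sub (q2.pow 2)))
  have t13 := ((((q6.add (q1.const_mul 6)).sub (q3.const_mul 2)).sub (q2.const_mul 3)).const_mul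
    α).add (hid.mul ((q1.mul q6).sub (q2.mul q3)))
  have t23 := (((((q6.const_mul 2).add (q2.const_mul 6)).sub (q4.const_mul 3)).sub
    (q3.const_mul 4)).const_mul α).add (hid.mul ((q2.mul q6).sub (q3.mul q4)))
  have tG : Tendsto G (𝓝[>] 0) _ :=
    ((((hid.mul q2).const_add (2 * α)).mul t23).sub (((hid.mul q5).const_add (5 * α)).mul t13)).add
      (((hid.mul q8).const_add (8 * α)).mul t12)
  -- The three minors tend to `4αC`, `12αC`, `12αC`, so `G` tends to `(24 - 60 + 32) α ^ 2 C = -4 α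
  -- ^ 2 C`.
  have hneg : ∀ᶠ x in 𝓝[>] 0, G x < 0 := by
    refine tG.eventually_lt_const ?_
    have : 0 < α ^ 2 * C := by positivity
    ring_nf
    linarith
  obtain ⟨x, hG, hx⟩ := (hneg.and hpos).exists
  refine ⟨NNReal.mk x hx.le, ?_⟩
  let f : ℝ → ℝ := fun m => x * (α * m + x * q m x)
  have hmat : (Matrix.of fun a b => ((rankThreeKernel (NNReal.mk x hx.le) a b ^ α : ℝ≥0) : ℝ)) =
      Matrix.of ![![1, 1, 1, 1], ![1, 1 + f 1, 1 + f 2, 1 + f 3], ![1, 1 + f 2, 1 + f 4, 1 + f 6],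
      ![1, 1 + f 2, 1 + f 5, 1 + f 8]] := by
    ext a b
    have hval : ((rankThreeKernel (NNReal.mk x hx.le) a b ^ α : ℝ≥0) : ℝ) =
        (1 + x * (rankThreeSlope a b : ℝ)) ^ α := by
      rw [NNReal.coe_rpow, coe_rankThreeKernel]
      rfl
    rw [Matrix.of_apply, Matrix.of_apply, hval]
    have e1 := hqe 1 x (by norm_num) hx
    have e2 := hqe 2 x (by norm_num) hx
    have e3 := hqe 3 x (by norm_num) hx
    have e4 := hqe 4 x (by norm_num) hx
    have e5 := hqe 5 x (by norm_num) hx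
    have e6 := hqe 6 x (by norm_num) hx
    have e8 := hqe 8 x (by norm_num) hx
    rw [mul_one, mul_one] at e1
    fin_cases a <;> fin_cases b <;> simp [rankThreeSlope, f, e1, e2, e3, e4, e5, e6, e8]
  rw [hmat, det_bordered_ones]
  have : f 2 * (f 2 * f 6 - f 3 * f 4) - f 5 * (f 1 * f 6 - f 2 * f 3)
      + f 8 * (f 1 * f 4 - f 2 * f 2) = x ^ 4 * G x := by
    simp only [f, G, m12, m13, m23]
    ring
  rw [this]
  exact mul_neg_of_pos_of_neg (by positivity) hG

lemma TransformsTN.exponent_eq_one {p : ℕ} {k : Fin p → ℕ∞} {l : ℕ∞} {j : Fin p} {c : ℝ≥0} {α : ℝ}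
    (hF : TransformsTN (Fin 4) (Fin 4) k l fun t => c * t j ^ α) (hl : 4 ≤ l) (hc : 0 < c)
    (hα : 1 ≤ α) : α = 1 := by
  by_contra hne
  obtain ⟨x, hx⟩ := exists_det_rpow_neg (lt_of_le_of_ne hα (Ne.symm hne))
  have h := hF.det_nonneg (by norm_num) (by exact_mod_cast hl)
    (isTN_update (isTN_rankThreeKernel (k j) x))
  have he : (Matrix.of fun a b : Fin 4 => ((c * Function.update (1 : Fin p → ℝ≥0) j
      (rankThreeKernel x a b) j ^ α : ℝ≥0) : ℝ)) =
      (c : ℝ) • Matrix.of fun a b => ((rankThreeKernel x a b ^ α : ℝ≥0) : ℝ) := by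
    ext a b
    simp
  rw [he, Matrix.det_smul] at h
  exact absurd h (mul_neg_of_pos_of_neg (pow_pos (NNReal.coe_pos.2 hc) _) hx).not_ge

end ExponentOne

/-! ### Tridiagonal matrices and sharpness of the order. -/

section Tridiagonal

/-- The tridiagonal Toeplitz kernel on `ℕ × ℕ` with diagonal entries `d` and off-diagonal
entries `1`. -/
def tridiag (d : ℝ) (i j : ℕ) : ℝ :=
  if i = j then d else if i = j + 1 ∨ j = i + 1 then 1 else 0

/-- The minors of `tridiag d`. -/
noncomputable def tridiagMinor (d : ℝ) {r : ℕ} (x y : Fin r → ℕ) : ℝ :=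
  (Matrix.of fun i j => tridiag d (x i) (y j)).det

variable {d : ℝ}

lemma tridiag_nonneg (hd : 0 ≤ d) (i j : ℕ) : 0 ≤ tridiag d i j := by
  unfold tridiag
  split_ifs <;> simp [hd]

lemma tridiag_comm (i j : ℕ) : tridiag d i j = tridiag d j i := by
  unfold tridiag
  split_ifs <;> first | rfl | omega

lemma tridiag_of_add_two_le {i j : ℕ} (h : i + 2 ≤ j) : tridiag d i j = 0 := by
  unfold tridiag
  split_ifs <;> first | rfl | omega

lemma tridiagMinor_comm {r : ℕ} (x y : Fin r → ℕ) : tridiagMinor d x y = tridiagMinor d y x := by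
  rw [tridiagMinor, ← Matrix.det_transpose]
  congr 1
  ext i j
  exact tridiag_comm _ _

/-- All later columns lie at distance at least two from `x 0`, so the first row has at most one
nonzero entry. -/
lemma tridiagMinor_of_lt {r : ℕ} {x y : Fin (r + 1) → ℕ} (hy : StrictMono y) (h : x 0 < y 0) :
    tridiagMinor d x y = tridiag d (x 0) (y 0) * tridiagMinor d (Fin.tail x) (Fin.tail y) := by
  rw [tridiagMinor, Matrix.det_succ_row_zero, Fin.sum_univ_succ, Finset.sum_eq_zero]
  · simp [tridiagMinor, Matrix.submatrix, Fin.tail]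
  · intro j _
    have := hy (Fin.succ_pos j)
    rw [Matrix.of_apply, tridiag_of_add_two_le (by omega)]
    simp

lemma tridiagMinor_of_ne {r : ℕ} {x y : Fin (r + 1) → ℕ} (hx : StrictMono x) (hy : StrictMono y)
    (h : x 0 ≠ y 0) :
    tridiagMinor d x y = tridiag d (x 0) (y 0) * tridiagMinor d (Fin.tail x) (Fin.tail y) := by
  rcases h.lt_or_gt with h | h
  · exact tridiagMinor_of_lt hy h
  · rw [tridiagMinor_comm, tridiagMinor_of_lt hx h, tridiag_comm, tridiagMinor_comm]

/-- Row `x 0` can meet only the columns `y 0`, `y 1`, and column `y 0` only the rows `x 0`, `x 1`: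
this is the continuant recurrence. -/
lemma tridiagMinor_of_eq {r : ℕ} {x y : Fin (r + 2) → ℕ} (hx : StrictMono x) (hy : StrictMono y)
    (h : x 0 = y 0) :
    tridiagMinor d x y = d * tridiagMinor d (Fin.tail x) (Fin.tail y)
      - tridiag d (x 0) (y 1) * tridiag d (x 1) (y 0)
        * tridiagMinor d (Fin.tail (Fin.tail x)) (Fin.tail (Fin.tail y)) := by
  have hcol : ((Matrix.of fun i j => tridiag d (x i) (y j)).submatrix Fin.succ
      (Fin.succAbove 1)).det = tridiag d (x 1) (y 0)
        * tridiagMinor d (Fin.tail (Fin.tail x)) (Fin.tail (Fin.tail y)) := by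
    rw [Matrix.det_succ_column_zero, Fin.sum_univ_succ, Finset.sum_eq_zero]
    · simp [tridiagMinor, Matrix.submatrix, Fin.tail]
    · intro i _
      have h1 := hx (Fin.succ_lt_succ_iff.2 (Fin.succ_pos i))
      have h2 := hx (Fin.succ_pos (0 : Fin (r + 1)))
      have : tridiag d (x i.succ.succ) (y 0) = 0 := by
        rw [tridiag_comm]
        exact tridiag_of_add_two_le (by omega)
      simp [this]
  rw [tridiagMinor, Matrix.det_succ_row_zero, Fin.sum_univ_succ, Fin.sum_univ_succ,
    Finset.sum_eq_zero]
  · rw [Fin.succ_zero_eq_one, hcol]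
    have h0 : tridiag d (x 0) (y 0) = d := by simp [tridiag, h]
    simp [tridiagMinor, Matrix.submatrix, Fin.tail, h0]
    ring
  · intro j _
    have h1 := hy (Fin.succ_lt_succ_iff.2 (Fin.succ_pos j))
    have h2 := hy (Fin.succ_pos (0 : Fin (r + 1)))
    rw [Matrix.of_apply, tridiag_of_add_two_le (by omega)]
    simp

lemma strictMono_tail {r : ℕ} {x : Fin (r + 1) → ℕ} (hx : StrictMono x) :
    StrictMono (Fin.tail x) :=
  fun _ _ h => hx (Fin.succ_lt_succ_iff.2 h)

variable {S : ℕ → ℝ}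

/-- Minors of `tridiag d`, bordered by a contiguous block of size `s` on the top left, are
nonnegative as long as the continuants `S` are. -/
lemma tridiagMinor_bordered_nonneg (hd : 0 ≤ d) (hS : ∀ m, S (m + 2) = d * S (m + 1) - S m)
    (hS0 : S 0 = 0) (hS1 : 0 < S 1) {n : ℕ} (hn : ∀ m ≤ n, 0 ≤ S m) (r : ℕ) :
    ∀ (s : ℕ) (x y : Fin (r + 1) → ℕ), StrictMono x → StrictMono y → s + r + 2 ≤ n →
      0 ≤ S (s + 1) * tridiagMinor d x y
        - (if x 0 = y 0 then S s else 0) * tridiagMinor d (Fin.tail x) (Fin.tail y) := by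
  -- When `x 0 = y 0`, the quantity is `S 1` times the minor enlarged by `s` consecutive indices
  -- just before `x 0`; the hypothesis `s + r + 2 ≤ n` keeps its order `s + r + 1` below `n`.
  -- Carrying the block makes the induction close: `s = 0` recovers the bare minor.
  induction r with
  | zero =>
    intro s x y hx hy hs
    have h1 := hn (s + 1) (by omega)
    have h2 := hn (s + 2) (by omega)
    rw [hS] at h2
    have hM : tridiagMinor d x y = tridiag d (x 0) (y 0) := by simp [tridiagMinor]
    have hM' : tridiagMinor d (Fin.tail x) (Fin.tail y) = 1 := Matrix.det_fin_zero
    rw [hM, hM']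
    split_ifs with h
    · simp only [tridiag, h, if_true]
      linarith
    · have := mul_nonneg h1 (tridiag_nonneg hd (x 0) (y 0))
      linarith
  | succ r ih =>
    intro s x y hx hy hs
    have hx' := strictMono_tail hx
    have hy' := strictMono_tail hy
    have h1 := hn (s + 1) (by omega)
    have h2 := hn (s + 2) (by omega)
    have ht : 0 ≤ tridiagMinor d (Fin.tail x) (Fin.tail y) := by
      have := ih 0 _ _ hx' hy' (by omega)
      rw [hS0, ite_self, zero_mul, sub_zero] at this
      exact nonneg_of_mul_nonneg_right this hS1
    split_ifs with h
    · rw [tridiagMinor_of_eq hx hy h]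
      have hrw : ∀ c : ℝ, S (s + 1) * (d * tridiagMinor d (Fin.tail x) (Fin.tail y)
          - c * tridiagMinor d (Fin.tail (Fin.tail x)) (Fin.tail (Fin.tail y)))
          - S s * tridiagMinor d (Fin.tail x) (Fin.tail y)
          = S (s + 2) * tridiagMinor d (Fin.tail x) (Fin.tail y) - S (s + 1) * c
            * tridiagMinor d (Fin.tail (Fin.tail x)) (Fin.tail (Fin.tail y)) := fun c => by
        rw [hS]; ring
      rw [hrw]
      -- Either both sequences continue at `x 0 + 1` and the block absorbs `x 0`, or the
      -- off-diagonal correction vanishes and the block splits off with factor `S (s + 2)`.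
      by_cases hc : y 1 = x 0 + 1 ∧ x 1 = x 0 + 1
      · have := ih (s + 1) _ _ hx' hy' (by omega)
        have he : Fin.tail x 0 = Fin.tail y 0 := by
          change x 1 = y 1
          omega
        rw [if_pos he] at this
        have t1 : tridiag d (x 0) (y 1) = 1 := by simp [tridiag, hc.1]
        have t2 : tridiag d (x 1) (y 0) = 1 := by simp [tridiag, hc.2, ← h]
        rw [t1, t2, mul_one, mul_one]
        exact this
      · have hxl := hx (show (0 : Fin (r + 2)) < 1 by simp)
        have hyl := hy (show (0 : Fin (r + 2)) < 1 by simp)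
        have : tridiag d (x 0) (y 1) * tridiag d (x 1) (y 0) = 0 := by
          by_cases hy1 : y 1 = x 0 + 1
          · have : x 1 ≠ x 0 + 1 := fun hx1 => hc ⟨hy1, hx1⟩
            rw [tridiag_comm (x 1), tridiag_of_add_two_le (j := x 1) (by omega), mul_zero]
          · rw [tridiag_of_add_two_le (by omega), zero_mul]
        rw [this, mul_zero, zero_mul, sub_zero]
        exact mul_nonneg h2 ht
    · rw [tridiagMinor_of_ne hx hy h, zero_mul, sub_zero]
      exact mul_nonneg h1 (mul_nonneg (tridiag_nonneg hd _ _) ht)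

lemma tridiagMinor_contiguous (hS : ∀ m, S (m + 2) = d * S (m + 1) - S m) (hS0 : S 0 = 0)
    (m : ℕ) : ∀ a : ℕ, S 1 * tridiagMinor d (fun i : Fin m => a + (i : ℕ)) (fun i => a + (i : ℕ))
      = S (m + 1) := by
  have htail : ∀ (m a : ℕ), Fin.tail (fun i : Fin (m + 1) => a + (i : ℕ)) =
      fun i : Fin m => (a + 1) + (i : ℕ) := fun m a => by
    funext i
    simp only [Fin.tail, Fin.val_succ]
    omega
  induction m using Nat.twoStepInduction with
  | zero =>
    intro a
    simp [tridiagMinor]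
  | one =>
    intro a
    simp [tridiagMinor, tridiag, hS, hS0, mul_comm]
  | more m ih1 ih2 =>
    intro a
    have hmono : StrictMono fun i : Fin (m + 2) => a + (i : ℕ) := fun i j h => by
      simpa using h
    rw [tridiagMinor_of_eq hmono hmono rfl, htail, htail, hS, ← ih2 (a + 1), ← ih1 (a + 1 + 1)]
    have h1 : tridiag d (a + ((0 : Fin (m + 2)) : ℕ)) (a + ((1 : Fin (m + 2)) : ℕ)) = 1 := by
      simp [tridiag]
    rw [tridiag_comm (a + ((1 : Fin (m + 2)) : ℕ)), h1]
    ring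

/-- For every `n ≥ 2` there is an `n × n` matrix with negative determinant whose smaller minors are
all nonnegative. -/
lemma exists_isTN_of_lt_det_neg {n : ℕ} (hn : 2 ≤ n) : ∃ A : Fin n → Fin n → ℝ≥0,
    (∀ k : ℕ∞, k < n → IsTN k A) ∧ (kernelMinor A id id).det < 0 := by
  have hn0 : (0 : ℝ) < n := by exact_mod_cast (by omega : 0 < n)
  -- With diagonal `2 cos θ`, contiguous blocks of size `m` have determinant `sin ((m + 1) θ) / sin
  -- θ`. For `θ = π / n` this is nonnegative up to `m = n - 1` and equals `-1` at `m = n`.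
  set θ : ℝ := Real.pi / n with hθ
  have hnθ : n * θ = Real.pi := by rw [hθ]; field_simp
  have hθ0 : 0 < θ := div_pos Real.pi_pos hn0
  have hθ2 : θ ≤ Real.pi / 2 :=
    div_le_div_of_nonneg_left Real.pi_pos.le (by norm_num) (by exact_mod_cast hn)
  set d : ℝ := 2 * Real.cos θ with hd'
  have hd : 0 ≤ d := mul_nonneg zero_le_two (Real.cos_nonneg_of_mem_Icc ⟨by linarith, hθ2⟩)
  let S : ℕ → ℝ := fun m => Real.sin (m * θ)
  have hS : ∀ m, S (m + 2) = d * S (m + 1) - S m := fun m => by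
    have e1 : ((m + 2 : ℕ) : ℝ) * θ = (m + 1 : ℕ) * θ + θ := by push_cast; ring
    have e2 : (m : ℝ) * θ = (m + 1 : ℕ) * θ - θ := by push_cast; ring
    simp only [S, d]
    rw [e1, e2, Real.sin_add, Real.sin_sub]
    ring
  have hS0 : S 0 = 0 := by simp [S]
  have hS1 : 0 < S 1 := by
    simpa [S] using Real.sin_pos_of_pos_of_lt_pi hθ0 (by linarith [Real.pi_pos])
  have hSn : ∀ m ≤ n, 0 ≤ S m := fun m hm => by
    refine Real.sin_nonneg_of_nonneg_of_le_pi (by positivity) ?_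
    rw [← hnθ]
    exact mul_le_mul_of_nonneg_right (by exact_mod_cast hm) hθ0.le
  have hSneg : S (n + 1) = -S 1 := by
    simp only [S]
    rw [show ((n + 1 : ℕ) : ℝ) * θ = (1 : ℕ) * θ + Real.pi by rw [← hnθ]; push_cast; ring,
      Real.sin_add_pi]
  let A : Fin n → Fin n → ℝ≥0 := fun i j => (tridiag d i j).toNNReal
  have hA : ∀ i j, (A i j : ℝ) = tridiag d i j := fun i j =>
    Real.coe_toNNReal _ (tridiag_nonneg hd i j)
  have hminor : ∀ {r : ℕ} (x y : Fin r → Fin n), (kernelMinor A x y).det =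
      tridiagMinor d (fun i => (x i : ℕ)) (fun i => (y i : ℕ)) := fun x y => by
    simp only [kernelMinor, hA, tridiagMinor]
  refine ⟨A, fun k hk => isTN_fin (fun r hr hrn _ x hx y hy => ?_) fun h => ?_, ?_⟩
  · obtain ⟨r, rfl⟩ : ∃ q, r = q + 1 := ⟨r - 1, by omega⟩
    have := tridiagMinor_bordered_nonneg hd hS hS0 hS1 hSn r 0 (fun i => (x i : ℕ))
      (fun i => (y i : ℕ)) (fun _ _ h => hx h) (fun _ _ h => hy h) (by omega)
    rw [hS0, ite_self, zero_mul, sub_zero] at this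
    rw [hminor]
    exact nonneg_of_mul_nonneg_right this hS1
  · exact absurd hk h.not_gt
  · rw [hminor]
    have := tridiagMinor_contiguous hS hS0 n 0
    simp only [zero_add] at this
    rw [hSneg] at this
    simp only [id]
    nlinarith

lemma TransformsTN.order_le {n p : ℕ} {k : Fin p → ℕ∞} {l : ℕ∞} {j : Fin p} {c : ℝ≥0}
    (hF : TransformsTN (Fin n) (Fin n) k l fun t => c * t j) (hn : 2 ≤ n) (hl : (n : ℕ∞) ≤ l)
    (hc : 0 < c) : (n : ℕ∞) ≤ k j := by
  by_contra hlt
  obtain ⟨A, hA, hdet⟩ := exists_isTN_of_lt_det_neg hn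
  have h := hF.det_nonneg (by omega) hl (isTN_update (hA (k j) (not_le.1 hlt)))
  have he : (Matrix.of fun a b : Fin n => ((c * Function.update (1 : Fin p → ℝ≥0) j (A a b) j :
      ℝ≥0) : ℝ)) = (c : ℝ) • kernelMinor A id id := by
    ext a b
    simp [kernelMinor]
  rw [he, Matrix.det_smul] at h
  exact absurd h (mul_neg_of_pos_of_neg (pow_pos (NNReal.coe_pos.2 hc) _) hdet).not_ge

end Tridiagonal

/-! ### Assembly of the four cases. -/

theorem theorem1p4 {X Y : Type*} [LinearOrder X] [LinearOrder Y] [Nonempty X] [Nonempty Y]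
    {p : ℕ} (hp : 1 ≤ p) (k : Fin p → ℕ∞) (hk : ∀ j, 1 ≤ k j) (l : ℕ∞) (hl : 1 ≤ l)
    (N : ℕ∞) (hN : N = min (min (ENat.card X) (ENat.card Y)) l) :
    (N = 1 → ∀ F : (Fin p → ℝ≥0) → ℝ≥0, TransformsTN X Y k l F) ∧
    -- the classification, and the constraint on every representation of a nonzero `F`
    (N = 2 → ∀ F : (Fin p → ℝ≥0) → ℝ≥0,
      (TransformsTN X Y k l F ↔
        ∃ (J : Finset (Fin p)) (c : ℝ≥0) (α : Fin p → ℝ≥0),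
          F = powerIndicator J c α ∧ ∀ j, k j < N → j ∈ J ∧ α j = 0) ∧
      (TransformsTN X Y k l F →
        ∀ (J : Finset (Fin p)) (c : ℝ≥0) (α : Fin p → ℝ≥0),
          0 < c → F = powerIndicator J c α → ∀ j, k j < N → j ∈ J ∧ α j = 0)) ∧
    (N = 3 → ∀ F : (Fin p → ℝ≥0) → ℝ≥0,
      TransformsTN X Y k l F ↔
        (∃ c : ℝ≥0, F = fun _ => c) ∨
        ∃ (j : Fin p) (c : ℝ≥0) (α : ℝ),
          0 < c ∧ 1 ≤ α ∧ N ≤ k j ∧ F = fun t => c * t j ^ α) ∧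
    (4 ≤ N → ∀ F : (Fin p → ℝ≥0) → ℝ≥0,
      TransformsTN X Y k l F ↔
        (∃ c : ℝ≥0, F = fun _ => c) ∨
        ∃ (j : Fin p) (c : ℝ≥0), 0 < c ∧ N ≤ k j ∧ F = fun t => c * t j) := by
  have hNX : N ≤ ENat.card X := hN ▸ (min_le_left _ _).trans (min_le_left _ _)
  have hNY : N ≤ ENat.card Y := hN ▸ (min_le_left _ _).trans (min_le_right _ _)
  have hNl : N ≤ l := hN ▸ min_le_right _ _
  have hfin : ∀ {F : (Fin p → ℝ≥0) → ℝ≥0}, TransformsTN X Y k l F → ∀ n : ℕ, 1 ≤ n →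
      (n : ℕ∞) ≤ N → TransformsTN (Fin n) (Fin n) k l F := fun hF n hn h =>
    hF.fin hn (h.trans hNX) (h.trans hNY)
  have hconst : ∀ c : ℝ≥0, TransformsTN X Y k l fun _ => c := fun c K _ => isTN_const l c
  refine ⟨?_, ?_, ?_, ?_⟩
  · rintro rfl F K -
    refine isTN_of_le hN fun r hr hr1 x _ y _ => ?_
    obtain rfl : r = 1 := le_antisymm (by exact_mod_cast hr1) hr
    exact det_kernelMinor_one_nonneg _ x y
  · rintro rfl F
    refine ⟨⟨fun hF => (hfin hF 2 (by norm_num) le_rfl).eq_powerIndicator hNl, ?_⟩,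
      fun hF J c α hc h => (hfin hF 2 (by norm_num) le_rfl).mem_and_eq_zero hNl hc h⟩
    rintro ⟨J, c, α, rfl, h⟩
    exact transformsTN_powerIndicator hN h
  · rintro rfl F
    refine ⟨fun hF => (hfin hF 2 (by norm_num) (by norm_num)).exists_rpow
      (hfin hF 3 (by norm_num) le_rfl) hNl, ?_⟩
    rintro (⟨c, rfl⟩ | ⟨j, c, α, -, hα, hj, rfl⟩)
    · exact hconst c
    · exact fun K hK => isTN_of_le hN ((((hK j).mono hj).rpow hα).const_mul c)
  · intro h4 F
    have h3 : 3 ≤ N := le_trans (by norm_num) h4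
    refine ⟨fun hF => ?_, ?_⟩
    · refine ((hfin hF 2 (by norm_num) (le_trans (by norm_num) h3)).exists_rpow
        (hfin hF 3 (by norm_num) h3) (h3.trans hNl)).imp_right ?_
      rintro ⟨j, c, α, hc, hα, hj, rfl⟩
      obtain rfl := (hfin hF 4 (by norm_num) h4).exponent_eq_one (h4.trans hNl) hc hα
      simp only [NNReal.rpow_one] at hF ⊢
      refine ⟨j, c, hc, ?_, rfl⟩
      by_contra hlt
      rw [not_le] at hlt
      -- `N` may be infinite, but `k j < N` is finite, say `m`; testing on `m + 1` points already
      -- gives a contradiction.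
      obtain ⟨m, hm⟩ := ENat.ne_top_iff_exists.1 hlt.ne_top
      rw [← hm] at hlt
      have hm1 : ((m + 1 : ℕ) : ℕ∞) ≤ N := by
        rw [Nat.cast_add_one]
        exact Order.add_one_le_of_lt hlt
      have hm3 : 3 ≤ m := by
        rw [← hm] at hj
        exact_mod_cast hj
      have := (hfin hF (m + 1) (by omega) hm1).order_le (by omega) (hm1.trans hNl) hc
      rw [← hm] at this
      have : m + 1 ≤ m := by exact_mod_cast this
      omega
    · rintro (⟨c, rfl⟩ | ⟨j, c, -, hj, rfl⟩)
      · exact hconst c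
      · exact fun K hK => isTN_of_le hN (((hK j).mono hj).const_mul c)
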